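/- Let $\Omega\subset\mathbb C$ be a bounded simply connected domain whose boundary is rectifiable (has finite length), let $\beta:\mathbb D\to\Omega$ be a conformal bijection from the unit disc, and fix a holomorphic branch of $(\beta')^{1/2}$ on $\mathbb D$. Let $H^2$ be the Hardy space of $\mathbb D$, and let $E^2(\Omega)$ be the Hardy–Smirnov space of all $f:\Omega\to\mathbb C$ such that $Jf:=(\beta')^{1/2}\,(f\circ\beta)$ lies in $H^2$, with the norm $\|f\|_{E^2(\Omega)}=\|Jf\|_{H^2}$; thus $J:E^2(\Omega)\to H^2$ is unitary. Let $\Phi:\Omega\to\Omega$ be holomorphic, and put $$\varphi=\beta^{-1}\circ\Phi\circ\beta,\qquad w(z)=\left(\frac{\beta'(z)}{\beta'(\varphi(z))}\right)^{1/2}=\frac{(\beta')^{1/2}(z)}{(\beta')^{1/2}(\varphi(z))},\qquad T_{w,\varphi}f=w\cdot(f\circ\varphi).$$ Then $J$ carries the composition operator $C_\Phi f=f\circ\Phi$ on $E^2(\Omega)$ to the weighted composition operator $T_{w,\varphi}$ on $H^2$: for $f,g\in E^2(\Omega)$ one has $g=f\circ\Phi$ if and only if $Jg=T_{w,\varphi}Jf$.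 Suppose that the Denjoy–Wolff point of $\varphi$ (the point of $\overline{\mathbb D}$ to which the iterates of $\varphi$ converge uniformly on compact subsets of $\mathbb D$) exists and lies on the unit circle. Then $(T_{w,\varphi}^n)$ is unbounded in norm, and does not converge even weakly. That is: * If $T=T_{w,\varphi}$ is a bounded operator on $H^2$, then $\sup_n\|T^n\|=\infty$, and there is $f\in H^2$ such that $(T^nf)$ does not converge weakly in $H^2$. * In general, whether or not $T_{w,\varphi}$ is bounded or maps $H^2$ into $H^2$: there is no constant $C$ such that $T_{w,\varphi}^nf\in H^2$ and $\|T_{w,\varphi}^nf\|\le C\|f\|$ for all $n\ge 0$ and $f\in H^2$; and it is not the case that, for every $f\in H^2$, all the functions $T_{w,\varphi}^nf$ lie in $H^2$ and $(T_{w,\varphi}^nf)$ converges weakly in $H^2$. -/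

import Mathlib

open Filter Topology

noncomputable section

namespace HardySmirnov

/-- The open unit disc of the complex plane. -/
abbrev Disc : Set ℂ := Metric.ball (0 : ℂ) 1

/-! ### The Hardy space of the disc -/

lemma summable_coeff (a : lp (fun _ : ℕ => ℂ) 2) (z : Disc) :
    Summable fun n => a n * (z : ℂ) ^ n := by
  have hz : ‖(z : ℂ)‖ < 1 := mem_ball_zero_iff.mp z.2
  refine Summable.of_norm_bounded
    ((summable_geometric_of_lt_one (norm_nonneg _) hz).mul_left ‖a‖) fun n => ?_
  rw [norm_mul, norm_pow]
  gcongr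
  exact lp.norm_apply_le_norm (by norm_num) a n

/-- The function `z ↦ ∑ aₙ zⁿ` on the disc defined by a square-summable sequence `(aₙ)`. -/
def powerSum : lp (fun _ : ℕ => ℂ) 2 →ₗ[ℂ] (Disc → ℂ) where
  toFun a z := ∑' n, a n * (z : ℂ) ^ n
  map_add' a b := by
    funext z
    simp only [lp.coeFn_add, Pi.add_apply, add_mul]
    exact (summable_coeff a z).tsum_add (summable_coeff b z)
  map_smul' c a := by
    funext z
    simp only [lp.coeFn_smul, Pi.smul_apply, smul_eq_mul, RingHom.id_apply, mul_assoc]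
    exact tsum_mul_left

lemma powerSum_injective : Function.Injective powerSum := by
  rw [← LinearMap.ker_eq_bot, LinearMap.ker_eq_bot']
  intro a ha
  have hs : HasFPowerSeriesOnBall (fun _ : ℂ => (0 : ℂ))
      (FormalMultilinearSeries.ofScalars ℂ (fun n => a n)) 0 1 := by
    refine ⟨?_, one_pos, ?_⟩
    · refine FormalMultilinearSeries.le_radius_of_bound _ ‖a‖ (r := 1) fun n => ?_
      simpa [FormalMultilinearSeries.ofScalars_norm] using
        lp.norm_apply_le_norm (by norm_num) a n
    · intro y hy
      have hy' : y ∈ Disc := by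
        rw [← ENNReal.ofReal_one, Metric.eball_ofReal] at hy
        exact hy
      have h1 := (summable_coeff a ⟨y, hy'⟩).hasSum
      have h2 : ∑' n, a n * y ^ n = 0 := congrFun ha ⟨y, hy'⟩
      rw [h2] at h1
      simpa [FormalMultilinearSeries.ofScalars_apply_eq, mul_comm] using h1
  have h0 := hs.hasFPowerSeriesAt.eq_zero
  rw [FormalMultilinearSeries.ofScalars_series_eq_zero] at h0
  ext n
  simpa using congrFun h0 n

/-- The vector space of all functions `f(z) = ∑ aₙ zⁿ` on the disc with `∑ |aₙ|² < ∞`. -/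
def hardySubmodule : Submodule ℂ (Disc → ℂ) := LinearMap.range powerSum

/-- The Hardy space `H²` of the disc. It is a type of its own, so that it carries the Hilbert
space topology and not the topology of pointwise convergence. -/
def H2 : Type := hardySubmodule

namespace H2

instance : AddCommGroup H2 := inferInstanceAs (AddCommGroup hardySubmodule)

instance : Module ℂ H2 := inferInstanceAs (Module ℂ hardySubmodule)

/-- An element of `H²` is a function on the disc. -/
instance : FunLike H2 Disc ℂ where
  coe f := f.1
  coe_injective _ _ h := Subtype.ext h

/-- The sequence of Taylor coefficients, as a linear bijection from `H²` onto `ℓ²`. -/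
def coeff : H2 ≃ₗ[ℂ] lp (fun _ : ℕ => ℂ) 2 :=
  (LinearEquiv.ofInjective powerSum powerSum_injective).symm

/-- The norm `(∑ |aₙ|²)^(1/2)`. -/
instance : NormedAddCommGroup H2 :=
  NormedAddCommGroup.induced H2 (lp (fun _ : ℕ => ℂ) 2) coeff.toLinearMap coeff.injective

instance : InnerProductSpace ℂ H2 := InnerProductSpace.induced coeff.toLinearMap

end H2

/-! ### Conformal bijections from the disc onto a domain -/

/-- A conformal bijection `β` from the disc onto `Ω`: a map that is holomorphic on the disc and
restricts to a bijection from the disc onto `Ω`. (Its values off the disc are irrelevant.) -/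
structure ConformalBijection (Ω : Set ℂ) where
  toFun : ℂ → ℂ
  differentiableOn : DifferentiableOn ℂ toFun Disc
  bijOn : Set.BijOn toFun Disc Ω

/-- The derivative of an injective holomorphic function has no zeros. -/
lemma deriv_ne_zero_of_injOn {f : ℂ → ℂ} {U : Set ℂ} (hU : IsOpen U)
    (hf : DifferentiableOn ℂ f U) (hinj : Set.InjOn f U) {z : ℂ} (hz : z ∈ U) :
    deriv f z ≠ 0 := by
  intro hd
  have hUz : U ∈ 𝓝 z := hU.mem_nhds hz
  have hfa : AnalyticAt ℂ f z := hf.analyticAt hUz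
  have hFa : AnalyticAt ℂ (fun x => f x - f z) z := hfa.sub analyticAt_const
  have hfin : analyticOrderAt (fun x => f x - f z) z ≠ ⊤ := by
    intro h
    rw [analyticOrderAt_eq_top] at h
    have h1 : ∀ᶠ x in 𝓝[≠] z, False := by
      filter_upwards [h.filter_mono nhdsWithin_le_nhds, self_mem_nhdsWithin,
        nhdsWithin_le_nhds hUz] with x hx hxz hxU
      exact hxz (hinj hxU hz (sub_eq_zero.mp hx))
    exact h1.exists.choose_spec
  obtain ⟨n, hn⟩ := ENat.ne_top_iff_exists.mp hfin
  obtain ⟨g, hg, hg0, hfg⟩ := (hFa.analyticOrderAt_eq_natCast).mp hn.symm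
  -- the order is at least two
  have hn2 : 2 ≤ n := by
    by_contra hlt
    have h01 : n = 0 ∨ n = 1 := by omega
    rcases h01 with rfl | rfl
    · have := hfg.self_of_nhds
      simp at this
      exact hg0 this.symm
    · have h0 := ((hasDerivAt_id z).sub_const z).mul hg.differentiableAt.hasDerivAt
      have h1 : HasDerivAt (fun x => (x - z) ^ 1 • g x) (g z) z := by
        have h00 : 1 * g z + (id z - z) * deriv g z = g z := by simp
        rw [h00] at h0
        exact h0.congr_of_eventuallyEq (.of_forall fun x => by simp)
      have h2 : HasDerivAt (fun x => f x - f z) (g z) z := h1.congr_of_eventuallyEq hfg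
      have h3 : HasDerivAt (fun x => f x - f z) 0 z := by
        rw [← hd]; exact hfa.differentiableAt.hasDerivAt.sub_const _
      exact hg0 (h2.unique h3)
  have hn0 : (n : ℂ) ≠ 0 := by exact_mod_cast (by omega : n ≠ 0)
  -- a local coordinate `k` with `f x - f z = g z * k x ^ n`
  set h : ℂ → ℂ := fun x => Complex.exp (Complex.log (g x / g z) / n) with hh
  have hha : AnalyticAt ℂ h z := by
    have : AnalyticAt ℂ (fun x => g x / g z) z := hg.div analyticAt_const hg0
    exact ((this.clog (by simp [hg0])).div analyticAt_const hn0).cexp'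
  have hh1 : h z = 1 := by simp [hh, hg0]
  set k : ℂ → ℂ := fun x => (x - z) * h x with hk
  have hk0 : k z = 0 := by simp [hk]
  have hka : AnalyticAt ℂ k z := (analyticAt_id.sub analyticAt_const).mul hha
  have hkd : HasStrictDerivAt k 1 z := by
    have h0 := ((hasDerivAt_id z).sub_const z).mul hha.differentiableAt.hasDerivAt
    have h1 : HasDerivAt k 1 z := by
      have h00 : 1 * h z + (id z - z) * deriv h z = 1 := by simp [hh1]
      rw [h00] at h0
      exact h0
    have := hka.hasStrictDerivAt
    rwa [h1.deriv] at this
  have hmap : map k (𝓝 z) = 𝓝 0 := by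
    rw [← hk0]; exact hkd.map_nhds_eq one_ne_zero
  have hfk : ∀ᶠ x in 𝓝 z, f x - f z = g z * k x ^ n := by
    filter_upwards [hfg, hg.continuousAt.eventually_ne hg0] with x hx hgx
    rw [hx, hk]
    simp only [mul_pow, hh, ← Complex.exp_nat_mul, mul_div_cancel₀ _ hn0]
    rw [Complex.exp_log (div_ne_zero hgx hg0), smul_eq_mul]
    field_simp
  -- the image under `k` of a small neighbourhood contains a disc
  have him : k '' {x | x ∈ U ∧ f x - f z = g z * k x ^ n} ∈ 𝓝 (0 : ℂ) := by
    rw [← hmap]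
    exact image_mem_map (inter_mem hUz hfk)
  obtain ⟨ε, hε, hball⟩ := Metric.mem_nhds_iff.mp him
  set ζ : ℂ := Complex.exp (2 * Real.pi * Complex.I / n) with hζdef
  have hζ : IsPrimitiveRoot ζ n := Complex.isPrimitiveRoot_exp n (by omega)
  have hζ1 : ‖ζ‖ = 1 := hζ.norm'_eq_one (by omega)
  have hv : ‖((ε / 2 : ℝ) : ℂ)‖ = ε / 2 := by
    rw [Complex.norm_real, Real.norm_of_nonneg (by positivity)]
  obtain ⟨x, ⟨hxU, hx⟩, hxv⟩ := hball (show ((ε / 2 : ℝ) : ℂ) ∈ Metric.ball 0 ε by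
    rw [mem_ball_zero_iff, hv]; linarith)
  obtain ⟨y, ⟨hyU, hy⟩, hyv⟩ := hball (show ζ * ((ε / 2 : ℝ) : ℂ) ∈ Metric.ball 0 ε by
    rw [mem_ball_zero_iff, norm_mul, hζ1, hv]; linarith)
  have hxy : f x = f y := by
    rw [hxv] at hx
    rw [hyv, mul_pow, hζ.pow_eq_one, one_mul] at hy
    exact sub_left_inj.mp (hx.trans hy.symm)
  have := hinj hxU hyU hxy
  subst this
  rw [hxv] at hyv
  have hne : ((ε / 2 : ℝ) : ℂ) ≠ 0 := by
    exact_mod_cast (by positivity : (ε / 2 : ℝ) ≠ 0)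
  have : ζ = 1 := by
    have h5 : (1 : ℂ) * ((ε / 2 : ℝ) : ℂ) = ζ * ((ε / 2 : ℝ) : ℂ) := by rw [one_mul]; exact hyv
    exact (mul_right_cancel₀ hne h5).symm
  exact hζ.ne_one (by omega) this

namespace ConformalBijection

variable {Ω : Set ℂ} (β : ConformalBijection Ω)

/-- `β` as a bijection between the disc and `Ω`. -/
def equiv : Disc ≃ Ω := Set.BijOn.equiv β.toFun β.bijOn

lemma exists_sqrt_deriv :
    ∃ s : Disc → ℂ, Continuous s ∧ ∀ z : Disc, s z ^ 2 = deriv β.toFun z := by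
  have hsc : IsSimplyConnected Disc := by
    have : ContractibleSpace Disc :=
      (convex_ball (0 : ℂ) 1).contractibleSpace ⟨0, by simp⟩
    exact (inferInstance : SimplyConnectedSpace Disc)
  obtain ⟨s, hs, hs'⟩ := Complex.exists_continuousOn_pow_eq (n := 2) hsc Metric.isOpen_ball
    (β.differentiableOn.deriv Metric.isOpen_ball).continuousOn
    (by
      rintro ⟨z, hz, h⟩
      exact deriv_ne_zero_of_injOn Metric.isOpen_ball β.differentiableOn β.bijOn.injOn hz h)
    two_ne_zero
  exact ⟨fun z => s z, continuousOn_iff_continuous_domRestrict.mp hs, fun z => hs' z⟩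

/-- A continuous (hence holomorphic) branch of `(β')^(1/2)` on the disc. There are exactly two,
which differ by a sign. -/
def sqrtDeriv : Disc → ℂ := β.exists_sqrt_deriv.choose

lemma continuous_sqrtDeriv : Continuous β.sqrtDeriv := β.exists_sqrt_deriv.choose_spec.1

lemma sqrtDeriv_sq (z : Disc) : β.sqrtDeriv z ^ 2 = deriv β.toFun z :=
  β.exists_sqrt_deriv.choose_spec.2 z

lemma sqrtDeriv_ne_zero (z : Disc) : β.sqrtDeriv z ≠ 0 := by
  intro h
  refine deriv_ne_zero_of_injOn Metric.isOpen_ball β.differentiableOn β.bijOn.injOn z.2 ?_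
  rw [← β.sqrtDeriv_sq z, h, zero_pow two_ne_zero]

end ConformalBijection

/-! ### The Hardy–Smirnov space of a domain -/

variable {Ω : Set ℂ} (β : ConformalBijection Ω)

/-- The linear map `f ↦ (β')^(1/2) · (f ∘ β)` from functions on `Ω` to functions on the disc. -/
def pullback : (Ω → ℂ) →ₗ[ℂ] (Disc → ℂ) where
  toFun f z := β.sqrtDeriv z * f (β.equiv z)
  map_add' f g := by funext z; simp [mul_add]
  map_smul' c f := by funext z; simp [mul_left_comm]

/-- The Hardy–Smirnov space `E²(Ω)`: the functions `f` on `Ω` with `(β')^(1/2) · (f ∘ β) ∈ H²`. -/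
def E2 : Type := Submodule.comap (pullback β) hardySubmodule

namespace E2

instance : AddCommGroup (E2 β) :=
  inferInstanceAs (AddCommGroup (Submodule.comap (pullback β) hardySubmodule))

instance : Module ℂ (E2 β) :=
  inferInstanceAs (Module ℂ (Submodule.comap (pullback β) hardySubmodule))

/-- An element of `E²(Ω)` is a function on `Ω`. -/
instance : FunLike (E2 β) Ω ℂ where
  coe f := f.1
  coe_injective _ _ h := Subtype.ext h

/-- The bijective linear map `J : E²(Ω) → H²`, `J f = (β')^(1/2) · (f ∘ β)`. -/
def toH2 : E2 β ≃ₗ[ℂ] H2 where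
  toFun f := ⟨pullback β f.1, f.2⟩
  map_add' f g := Subtype.ext ((pullback β).map_add f.1 g.1)
  map_smul' c f := Subtype.ext ((pullback β).map_smul c f.1)
  invFun h := ⟨fun x => h (β.equiv.symm x) / β.sqrtDeriv (β.equiv.symm x), by
    have : pullback β (fun x => h (β.equiv.symm x) / β.sqrtDeriv (β.equiv.symm x)) = h.1 := by
      funext z
      simp only [pullback, LinearMap.coe_mk, AddHom.coe_mk, Equiv.symm_apply_apply]
      exact mul_div_cancel₀ _ (β.sqrtDeriv_ne_zero z)
    simpa only [Submodule.mem_comap, this] using h.2⟩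
  left_inv f := by
    refine Subtype.ext (funext fun x => ?_)
    change β.sqrtDeriv (β.equiv.symm x) * f.1 (β.equiv (β.equiv.symm x)) / _ = _
    rw [Equiv.apply_symm_apply, mul_div_cancel_left₀ _ (β.sqrtDeriv_ne_zero _)]
  right_inv h := by
    refine Subtype.ext (funext fun z => ?_)
    change β.sqrtDeriv z * (h.1 (β.equiv.symm (β.equiv z)) /
      β.sqrtDeriv (β.equiv.symm (β.equiv z))) = h.1 z
    rw [Equiv.symm_apply_apply, mul_div_cancel₀ _ (β.sqrtDeriv_ne_zero z)]

/-- The norm `‖f‖ = ‖J f‖`. -/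
instance : NormedAddCommGroup (E2 β) :=
  NormedAddCommGroup.induced (E2 β) H2 (toH2 β).toLinearMap (toH2 β).injective

instance : InnerProductSpace ℂ (E2 β) := InnerProductSpace.induced (toH2 β).toLinearMap

/-- `J` as a unitary operator from `E²(Ω)` onto `H²`. -/
def unitary : E2 β ≃ₗᵢ[ℂ] H2 where
  toLinearEquiv := toH2 β
  norm_map' _ := rfl

end E2

/-! ### Weighted composition operators, iteration -/

/-- The weighted composition map `f ↦ w · (f ∘ φ)` on all functions on the disc. -/
def weightedComp (w : Disc → ℂ) (φ : Disc → Disc) : Module.End ℂ (Disc → ℂ) where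
  toFun f z := w z * f (φ z)
  map_add' f g := by funext z; simp [mul_add]
  map_smul' c f := by funext z; simp [mul_left_comm]

/-- The self-map `φ = β⁻¹ ∘ Φ ∘ β` of the disc. -/
def conjMap (Φ : Ω → Ω) : Disc → Disc := fun z => β.equiv.symm (Φ (β.equiv z))

/-- The weight `w(z) = (β'(z) / β'(φ(z)))^(1/2)`, where `φ = β⁻¹ ∘ Φ ∘ β`. It does not depend on
the branch of `(β')^(1/2)`. -/
def smirnovWeight (Φ : Ω → Ω) : Disc → ℂ :=
  fun z => β.sqrtDeriv z / β.sqrtDeriv (conjMap β Φ z)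

/-- `α` is the Denjoy–Wolff point of `φ`: a point of the closed disc to which the iterates of `φ`
tend uniformly on the compact subsets of the disc. -/
def IsDenjoyWolffPoint (φ : Disc → Disc) (α : ℂ) : Prop :=
  ‖α‖ ≤ 1 ∧ ∀ K : Set Disc, IsCompact K →
    TendstoUniformlyOn (fun (n : ℕ) (z : Disc) => ((φ^[n] z : Disc) : ℂ)) (fun _ => α) atTop K

/-- Weak convergence of a sequence in `H²`. -/
def TendstoWeakly (u : ℕ → H2) (g : H2) : Prop :=
  ∀ ℓ : H2 →L[ℂ] ℂ, Tendsto (fun n => ℓ (u n)) atTop (𝓝 (ℓ g))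

end HardySmirnov

end

/-!
If `u = T_{w,φ}ⁿ f` lies in `H²`, its value at the origin is
`u(0) = (s(0) / s(vₙ)) f(vₙ)`, where `s = (β')^(1/2)` and `vₙ = φⁿ(0)`: the weights telescope.
Hence bounds for the powers, or weak convergence of all orbits (by the uniform boundedness
principle), give a constant `C` with `|s(0) / s(vₙ)| |f(vₙ)| ≤ C ‖f‖` for all `n` and all `f` in
`H²` (`exists_bound_of_tendsto`). For `f` the Szegő kernel at `vₙ` this reads
`|β'(0)| ≤ C² |β'(vₙ)| (1 - |vₙ|²)`.

On the other hand `Ω` has finite area, and so `∫ |β'|² < ∞` over the disc. By the sub-mean value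
inequality for `(β')²` on the disc of centre `v` and radius `1 - |v|`, the quantity
`π (1 - |v|)² |β'(v)|²` is at most the integral of `|β'|²` over that disc, which tends to `0` as
`|v| → 1` (`tendsto_one_sub_norm_mul_norm_deriv`). The Denjoy–Wolff point lies on the circle, so
`|vₙ| → 1`, and therefore `β'(0) = 0`, which is impossible for an injective map
(`not_exists_bound_weightedComp_pow`).
-/

noncomputable section

namespace HardySmirnov

open MeasureTheory

/-! ### The sub-mean value inequality over discs -/

/-- Integration over a disc in polar coordinates. -/
lemma setLIntegral_ball_eq_lintegral_circleMap {F : ℂ → ENNReal} (hF : Measurable F) (c : ℂ)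
    (r : ℝ) :
    ∫⁻ x in Metric.ball c r, F x =
      ∫⁻ ρ in Set.Ioo 0 r, ENNReal.ofReal ρ *
        ∫⁻ θ in Set.Ioo (-Real.pi) Real.pi, F (circleMap c ρ θ) := by
  have hcm : Measurable fun p : ℝ × ℝ => circleMap c p.1 p.2 := by
    unfold circleMap
    fun_prop
  have hpol : ∀ p ∈ polarCoord.target,
      ENNReal.ofReal p.1 • (Metric.ball c r).indicator F (c + Complex.polarCoord.symm p) =
        (Set.Iio r).indicator ENNReal.ofReal p.1 * F (circleMap c p.1 p.2) := by
    intro p hp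
    have hp0 : 0 < p.1 := by
      rw [polarCoord_target] at hp
      exact hp.1
    have h1 : c + Complex.polarCoord.symm p = circleMap c p.1 p.2 := by
      rw [Complex.polarCoord_symm_apply, circleMap, Complex.exp_mul_I]
      push_cast
      rfl
    have h2 : circleMap c p.1 p.2 ∈ Metric.ball c r ↔ p.1 ∈ Set.Iio r := by
      rw [Metric.mem_ball, dist_eq_norm, circleMap_sub_center, norm_circleMap_zero,
        abs_of_pos hp0, Set.mem_Iio]
    rw [h1]
    by_cases h : p.1 ∈ Set.Iio r
    · simp [Set.indicator_of_mem h, Set.indicator_of_mem (h2.mpr h)]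
    · simp [Set.indicator_of_notMem h, Set.indicator_of_notMem (fun h' => h (h2.mp h'))]
  rw [← lintegral_indicator Metric.isOpen_ball.measurableSet,
    ← lintegral_add_left_eq_self _ c, ← Complex.lintegral_comp_polarCoord_symm,
    setLIntegral_congr_fun polarCoord.open_target.measurableSet hpol, polarCoord_target,
    Measure.volume_eq_prod, setLIntegral_prod]
  · have h3 : ∀ ρ : ℝ, ∫⁻ θ in Set.Ioo (-Real.pi) Real.pi,
        (Set.Iio r).indicator ENNReal.ofReal ρ * F (circleMap c ρ θ) =
        (Set.Iio r).indicator (fun ρ => ENNReal.ofReal ρ *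
          ∫⁻ θ in Set.Ioo (-Real.pi) Real.pi, F (circleMap c ρ θ)) ρ := by
      intro ρ
      have hm : Measurable fun θ => F (circleMap c ρ θ) :=
        hF.comp (continuous_circleMap c ρ).measurable
      rw [lintegral_const_mul _ hm]
      by_cases h : ρ ∈ Set.Iio r
      · simp only [Set.indicator_of_mem h]
      · simp only [Set.indicator_of_notMem h, zero_mul]
    simp only [h3]
    rw [setLIntegral_indicator measurableSet_Iio, Set.inter_comm, Set.Ioi_inter_Iio]
  · refine Measurable.aemeasurable (Measurable.mul ?_ (hF.comp hcm))
    exact (ENNReal.measurable_ofReal.indicator measurableSet_Iio).comp measurable_fst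

/-- The sub-mean value inequality, obtained by comparing the integrals of `|g|` and of the
constant `|g c|` over each circle about `c`. -/
lemma enorm_mul_volume_ball_le {g : ℂ → ℂ} (hg : Measurable g) {c : ℂ} {r : ℝ}
    (hd : DifferentiableOn ℂ g (Metric.ball c r)) :
    ‖g c‖ₑ * volume (Metric.ball c r) ≤ ∫⁻ x in Metric.ball c r, ‖g x‖ₑ := by
  rw [← setLIntegral_const, setLIntegral_ball_eq_lintegral_circleMap measurable_const,
    setLIntegral_ball_eq_lintegral_circleMap hg.enorm]
  refine setLIntegral_mono' measurableSet_Ioo fun ρ hρ => mul_le_mul_right ?_ _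
  have hmean : Real.circleAverage g c ρ = g c := by
    refine DiffContOnCl.circleAverage ?_
    rw [abs_of_pos hρ.1]
    exact (hd.mono (Metric.closedBall_subset_ball hρ.2)).diffContOnCl_ball subset_rfl
  have hint : ∫ θ in Set.Ioo (-Real.pi) Real.pi, g (circleMap c ρ θ) =
      ∫ θ in Set.Ioo (-Real.pi) Real.pi, g c := by
    rw [← integral_Ioc_eq_integral_Ioo, ← integral_Ioc_eq_integral_Ioo,
      ← intervalIntegral.integral_of_le (by linarith [Real.pi_pos]),
      ← intervalIntegral.integral_of_le (by linarith [Real.pi_pos]),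
      intervalIntegral.integral_const, ← hmean, Real.circleAverage_def, smul_smul]
    have hper : Function.Periodic (fun θ => g (circleMap c ρ θ)) (2 * Real.pi) := fun θ => by
      simp only [periodic_circleMap c ρ θ]
    have hshift := hper.intervalIntegral_add_eq (-Real.pi) 0
    rw [zero_add, show -Real.pi + 2 * Real.pi = Real.pi by ring] at hshift
    rw [hshift, show Real.pi - -Real.pi = 2 * Real.pi by ring,
      mul_inv_cancel₀ Real.two_pi_pos.ne', one_smul]
  calc ∫⁻ _ in Set.Ioo (-Real.pi) Real.pi, ‖g c‖ₑ
      = ‖∫ _ in Set.Ioo (-Real.pi) Real.pi, g c‖ₑ := by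
        rw [setIntegral_const, setLIntegral_const, enorm_smul, mul_comm, Measure.real,
          Real.enorm_of_nonneg ENNReal.toReal_nonneg, ENNReal.ofReal_toReal (by simp)]
    _ ≤ ∫⁻ θ in Set.Ioo (-Real.pi) Real.pi, ‖g (circleMap c ρ θ)‖ₑ := by
        rw [← hint]
        exact enorm_integral_le_lintegral_enorm _

/-! ### The derivative of a univalent function near the circle -/

/-- The area formula: the real Jacobian determinant of a holomorphic `f` is `|f'|²`. -/
lemma lintegral_enorm_deriv_sq {f : ℂ → ℂ} {U : Set ℂ} (hU : IsOpen U)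
    (hf : DifferentiableOn ℂ f U) (hinj : Set.InjOn f U) :
    ∫⁻ z in U, ‖deriv f z ^ 2‖ₑ = volume (f '' U) := by
  rw [← lintegral_abs_det_fderiv_eq_addHaar_image volume hU.measurableSet
    (f' := fun z => (fderiv ℂ f z).restrictScalars ℝ)
    (fun z hz => ((hf.differentiableAt (hU.mem_nhds hz)).hasFDerivAt.restrictScalars
      ℝ).hasFDerivWithinAt) hinj]
  refine lintegral_congr fun z => ?_
  have hdet : ((fderiv ℂ f z).restrictScalars ℝ).det = ‖deriv f z‖ ^ 2 := by
    simp [ContinuousLinearMap.det, LinearMap.det_restrictScalars, Algebra.norm_complex_apply,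
      Complex.normSq_eq_norm_sq]
  rw [hdet, abs_of_nonneg (by positivity), ← norm_pow, ofReal_norm]

/-- An injective holomorphic function on the disc whose image has finite area belongs to the
little Bloch space. The integrals of `|f'|²` over the discs of centre `v` and radius `1 - |v|`
tend to `0` because the areas of these discs do. -/
lemma tendsto_one_sub_norm_mul_norm_deriv {f : ℂ → ℂ} (hf : DifferentiableOn ℂ f Disc)
    (hinj : Set.InjOn f Disc) (hvol : volume (f '' Disc) ≠ ⊤) {ι : Type*} {l : Filter ι}
    {v : ι → ℂ} (hv : ∀ i, v i ∈ Disc) (hlim : Tendsto (fun i => ‖v i‖) l (𝓝 1)) :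
    Tendsto (fun i => (1 - ‖v i‖) * ‖deriv f (v i)‖) l (𝓝 0) := by
  set r : ι → ℝ := fun i => 1 - ‖v i‖ with hr
  have hr0 : ∀ i, 0 ≤ r i := fun i => sub_nonneg.mpr (mem_ball_zero_iff.mp (hv i)).le
  have hrlim : Tendsto r l (𝓝 0) := by simpa using hlim.const_sub 1
  have hsub : ∀ i, Metric.ball (v i) (r i) ⊆ Disc := fun i =>
    Metric.ball_subset_ball' (by simp [hr])
  have hvol_ball : ∀ i, volume (Metric.ball (v i) (r i)) = ENNReal.ofReal (r i ^ 2 * Real.pi) := by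
    intro i
    rw [Complex.volume_ball, ENNReal.ofReal_mul (by positivity), ENNReal.ofReal_pow (hr0 i),
      ← NNReal.coe_real_pi, ENNReal.ofReal_coe_nnreal]
  have hball : Tendsto (fun i => volume (Metric.ball (v i) (r i))) l (𝓝 0) := by
    simp only [hvol_ball]
    simpa using ENNReal.tendsto_ofReal ((hrlim.pow 2).mul_const Real.pi)
  have hint : Tendsto (fun i => ∫⁻ z in Metric.ball (v i) (r i), ‖deriv f z ^ 2‖ₑ) l (𝓝 0) := by
    have h2 := tendsto_setLIntegral_zero (μ := volume.restrict Disc)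
      (f := fun z => ‖deriv f z ^ 2‖ₑ) (s := fun i => Metric.ball (v i) (r i)) (l := l)
      (by rwa [lintegral_enorm_deriv_sq Metric.isOpen_ball hf hinj])
      (tendsto_of_tendsto_of_tendsto_of_le_of_le tendsto_const_nhds hball (fun _ => zero_le)
        fun i => Measure.restrict_apply_le _ _)
    refine h2.congr fun i => ?_
    rw [Measure.restrict_restrict Metric.isOpen_ball.measurableSet,
      Set.inter_eq_self_of_subset_left (hsub i)]
  have hle : ∀ i, ENNReal.ofReal ((r i * ‖deriv f (v i)‖) ^ 2 * Real.pi) ≤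
      ∫⁻ z in Metric.ball (v i) (r i), ‖deriv f z ^ 2‖ₑ := by
    intro i
    refine le_trans (le_of_eq ?_) (enorm_mul_volume_ball_le ((measurable_deriv f).pow_const 2)
      (((hf.deriv Metric.isOpen_ball).mono (hsub i)).pow 2))
    rw [hvol_ball, ← ofReal_norm, ← ENNReal.ofReal_mul (norm_nonneg _), norm_pow]
    ring_nf
  have hsq := (ENNReal.tendsto_toReal ENNReal.zero_ne_top).comp
    (tendsto_of_tendsto_of_tendsto_of_le_of_le tendsto_const_nhds hint (fun _ => zero_le) hle)
  have hroot := ((hsq.div_const Real.pi).sqrt)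
  simp only [ENNReal.toReal_zero, zero_div, Real.sqrt_zero] at hroot
  refine hroot.congr fun i => ?_
  have hnn : 0 ≤ r i * ‖deriv f (v i)‖ := mul_nonneg (hr0 i) (norm_nonneg _)
  rw [Function.comp_apply, ENNReal.toReal_ofReal (by positivity),
    mul_div_cancel_right₀ _ Real.pi_ne_zero, Real.sqrt_sq hnn]

/-! ### Evaluations on the Hardy space -/

namespace H2

lemma apply_eq_tsum (f : H2) (z : Disc) : f z = ∑' n, coeff f n * (z : ℂ) ^ n := by
  have h : coeff.symm (coeff f) = f := coeff.symm_apply_apply f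
  conv_lhs => rw [← h]
  rfl

lemma norm_coeff (f : H2) : ‖coeff f‖ = ‖f‖ := rfl

instance : CompleteSpace H2 :=
  ((LinearIsometryEquiv.mk coeff norm_coeff).toIsometryEquiv.completeSpace_iff).mpr inferInstance

lemma norm_apply_le (f : H2) (z : Disc) : ‖f z‖ ≤ (1 - ‖(z : ℂ)‖)⁻¹ * ‖f‖ := by
  have hz : ‖(z : ℂ)‖ < 1 := mem_ball_zero_iff.mp z.2
  rw [apply_eq_tsum, mul_comm]
  refine tsum_of_norm_bounded ((hasSum_geometric_of_lt_one (norm_nonneg _) hz).mul_left ‖f‖)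
    fun n => ?_
  rw [norm_mul, norm_pow, ← norm_coeff]
  gcongr
  exact lp.norm_apply_le_norm (by norm_num) _ n

/-- Evaluation at a point of the disc, as a continuous functional on `H²`. -/
def eval (z : Disc) : H2 →L[ℂ] ℂ :=
  LinearMap.mkContinuous ⟨⟨fun f => f z, fun _ _ => rfl⟩, fun _ _ => rfl⟩ _
    fun f => norm_apply_le f z

lemma eval_apply (z : Disc) (f : H2) : eval z f = f z := rfl

/-- The function provided is the Szegő kernel `k(ζ) = 1 / (1 - z̄ζ)`, with coefficients `z̄ⁿ`; it
attains the norm of the evaluation at `z`. -/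
lemma exists_kernel (z : Disc) : ∃ k : H2, k z = ((1 - ‖(z : ℂ)‖ ^ 2)⁻¹ : ℝ) ∧
    ‖k‖ ^ 2 = (1 - ‖(z : ℂ)‖ ^ 2)⁻¹ := by
  have hz : ‖(z : ℂ)‖ < 1 := mem_ball_zero_iff.mp z.2
  have hgeo := hasSum_geometric_of_lt_one (sq_nonneg ‖(z : ℂ)‖)
    (pow_lt_one₀ (norm_nonneg _) hz two_ne_zero)
  have hterm : ∀ n : ℕ, ‖(starRingEnd ℂ) (z : ℂ) ^ n‖ ^ (2 : ENNReal).toReal =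
      (‖(z : ℂ)‖ ^ 2) ^ n := fun n => by
    rw [norm_pow, RCLike.norm_conj, ENNReal.toReal_ofNat, Real.rpow_two, pow_right_comm]
  have hmem : Memℓp (fun n : ℕ => (starRingEnd ℂ) (z : ℂ) ^ n) 2 := by
    refine memℓp_gen ?_
    simp only [hterm]
    exact hgeo.summable
  refine ⟨coeff.symm ⟨_, hmem⟩, ?_, ?_⟩
  · rw [apply_eq_tsum, LinearEquiv.apply_symm_apply]
    refine HasSum.tsum_eq ?_
    convert (Complex.hasSum_ofReal.mpr hgeo) using 2 with n
    change (starRingEnd ℂ) (z : ℂ) ^ n * (z : ℂ) ^ n = _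
    rw [← mul_pow, Complex.conj_mul']
    push_cast
    rfl
  · rw [← norm_coeff, LinearEquiv.apply_symm_apply]
    have h := lp.norm_rpow_eq_tsum (p := 2) (by norm_num)
      (⟨_, hmem⟩ : lp (fun _ : ℕ => ℂ) 2)
    rw [ENNReal.toReal_ofNat, Real.rpow_two] at h
    rw [h, ← hgeo.tsum_eq]
    exact tsum_congr hterm

end H2

/-! ### Powers of the weighted composition map -/

variable {Ω : Set ℂ} (β : ConformalBijection Ω)

/-- The weights along an orbit telescope. -/
lemma weightedComp_smirnovWeight_pow (Ψ : Ω → Ω) (n : ℕ) (f : Disc → ℂ) (z : Disc) :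
    (weightedComp (smirnovWeight β Ψ) (conjMap β Ψ) ^ n) f z =
      β.sqrtDeriv z / β.sqrtDeriv ((conjMap β Ψ)^[n] z) * f ((conjMap β Ψ)^[n] z) := by
  induction n generalizing f with
  | zero => simp [div_self (β.sqrtDeriv_ne_zero z)]
  | succ n ih =>
    rw [pow_succ, Module.End.mul_apply, ih, Function.iterate_succ_apply']
    simp only [weightedComp, smirnovWeight, LinearMap.coe_mk, AddHom.coe_mk]
    rw [← mul_assoc, div_mul_div_cancel₀ (β.sqrtDeriv_ne_zero _)]

lemma norm_sqrtDeriv_sq (z : Disc) : ‖β.sqrtDeriv z‖ ^ 2 = ‖deriv β.toFun z‖ := by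
  rw [← norm_pow, β.sqrtDeriv_sq]

/-- The evaluations at `z` of the powers of the weighted composition map are not uniformly bounded
functionals on `H²` if the orbit of `z` tends to the circle. -/
lemma not_exists_bound_weightedComp_pow (hΩ : Bornology.IsBounded Ω) (Ψ : Ω → Ω) (z : Disc)
    (hz : Tendsto (fun n => ‖((conjMap β Ψ)^[n] z : ℂ)‖) atTop (𝓝 1)) :
    ¬ ∃ C : ℝ, ∀ (n : ℕ) (f : H2),
      ‖(weightedComp (smirnovWeight β Ψ) (conjMap β Ψ) ^ n) f z‖ ≤ C * ‖f‖ := by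
  rintro ⟨C, hC⟩
  set v : ℕ → Disc := fun n => (conjMap β Ψ)^[n] z
  have hbound : ∀ n, ‖deriv β.toFun z‖ ≤
      2 * C ^ 2 * ((1 - ‖(v n : ℂ)‖) * ‖deriv β.toFun (v n)‖) := by
    intro n
    obtain ⟨k, hk, hk'⟩ := H2.exists_kernel (v n)
    -- The Szegő kernel at `v n` turns the bound at `n` into the desired inequality.
    have h1 := hC n k
    rw [weightedComp_smirnovWeight_pow] at h1
    change ‖β.sqrtDeriv z / β.sqrtDeriv (v n) * k (v n)‖ ≤ _ at h1
    have hvn : ‖(v n : ℂ)‖ < 1 := mem_ball_zero_iff.mp (v n).2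
    have hq : 0 < 1 - ‖(v n : ℂ)‖ ^ 2 :=
      sub_pos.mpr (pow_lt_one₀ (norm_nonneg _) hvn two_ne_zero)
    have hs : 0 < ‖deriv β.toFun (v n)‖ := by
      rw [← norm_sqrtDeriv_sq]
      exact pow_pos (norm_pos_iff.mpr (β.sqrtDeriv_ne_zero _)) 2
    have h2 := pow_le_pow_left₀ (norm_nonneg _) h1 2
    rw [hk, norm_mul, norm_div, mul_pow, div_pow, norm_sqrtDeriv_sq, norm_sqrtDeriv_sq, mul_pow,
      hk', Complex.norm_real, Real.norm_of_nonneg (inv_nonneg.mpr hq.le), pow_two _⁻¹,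
      ← mul_assoc, mul_le_mul_iff_left₀ (inv_pos.mpr hq), ← div_eq_mul_inv, div_div,
      div_le_iff₀ (mul_pos hs hq)] at h2
    refine h2.trans ?_
    have h3 : 1 - ‖(v n : ℂ)‖ ^ 2 ≤ 2 * (1 - ‖(v n : ℂ)‖) := by
      nlinarith [sq_nonneg (1 - ‖(v n : ℂ)‖)]
    calc C ^ 2 * (‖deriv β.toFun (v n)‖ * (1 - ‖(v n : ℂ)‖ ^ 2))
        ≤ C ^ 2 * (‖deriv β.toFun (v n)‖ * (2 * (1 - ‖(v n : ℂ)‖))) := by gcongr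
      _ = 2 * C ^ 2 * ((1 - ‖(v n : ℂ)‖) * ‖deriv β.toFun (v n)‖) := by ring
  have hvol : MeasureTheory.volume (β.toFun '' Disc) ≠ ⊤ := by
    rw [β.bijOn.image_eq]
    exact hΩ.measure_lt_top.ne
  have hlim := (tendsto_one_sub_norm_mul_norm_deriv β.differentiableOn β.bijOn.injOn hvol
    (v := fun n => (v n : ℂ)) (fun n => (v n).2) hz).const_mul (2 * C ^ 2)
  rw [mul_zero] at hlim
  have h0 := ge_of_tendsto' hlim hbound
  exact deriv_ne_zero_of_injOn Metric.isOpen_ball β.differentiableOn β.bijOn.injOn z.2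
    (norm_le_zero_iff.mp h0)

/-- The uniform boundedness principle is applied to evaluations at `z`, which are continuous on
`H²` even when the weighted composition map is not an operator on `H²`. -/
lemma exists_bound_of_tendsto (Ψ : Ω → Ω) (z : Disc)
    (h : ∀ f : H2, ∃ c : ℂ, Tendsto
      (fun n => (weightedComp (smirnovWeight β Ψ) (conjMap β Ψ) ^ n) f z) atTop (𝓝 c)) :
    ∃ C : ℝ, ∀ (n : ℕ) (f : H2),
      ‖(weightedComp (smirnovWeight β Ψ) (conjMap β Ψ) ^ n) f z‖ ≤ C * ‖f‖ := by
  set ℓ : ℕ → H2 →L[ℂ] ℂ := fun n =>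
    (β.sqrtDeriv z / β.sqrtDeriv ((conjMap β Ψ)^[n] z)) • H2.eval ((conjMap β Ψ)^[n] z) with hℓ
  have hℓ_apply : ∀ n (f : H2),
      ℓ n f = (weightedComp (smirnovWeight β Ψ) (conjMap β Ψ) ^ n) f z := fun n f => by
    rw [weightedComp_smirnovWeight_pow]
    rfl
  obtain ⟨C, hC⟩ := banach_steinhaus (g := ℓ) fun f => by
    obtain ⟨c, hc⟩ := h f
    simp only [hℓ_apply]
    obtain ⟨M, hM⟩ := (Metric.isBounded_range_of_tendsto _ hc).exists_norm_le
    exact ⟨M, fun n => hM _ ⟨n, rfl⟩⟩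
  refine ⟨C, fun n f => ?_⟩
  rw [← hℓ_apply]
  exact (ℓ n).le_of_opNorm_le (hC n) f

/-- The unitary `J` carries composition with `Ψ` to the weighted composition map. -/
lemma eq_comp_iff_unitary_eq_weightedComp (Ψ : Ω → Ω) (f g : E2 β) :
    ⇑g = ⇑f ∘ Ψ ↔ ⇑(E2.unitary β g) =
      weightedComp (smirnovWeight β Ψ) (conjMap β Ψ) ⇑(E2.unitary β f) := by
  have hJ : ∀ (h : E2 β) (z : Disc), E2.unitary β h z = β.sqrtDeriv z * h (β.equiv z) :=
    fun _ _ => rfl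
  have hW : ∀ z : Disc,
      weightedComp (smirnovWeight β Ψ) (conjMap β Ψ) ⇑(E2.unitary β f) z =
        β.sqrtDeriv z * f (Ψ (β.equiv z)) := by
    intro z
    simp only [weightedComp, smirnovWeight, LinearMap.coe_mk, AddHom.coe_mk, hJ]
    rw [← mul_assoc, div_mul_cancel₀ _ (β.sqrtDeriv_ne_zero _), conjMap, Equiv.apply_symm_apply]
  rw [funext_iff, funext_iff, ← β.equiv.forall_congr_right]
  refine forall_congr' fun z => ?_
  rw [hJ, hW, mul_right_inj' (β.sqrtDeriv_ne_zero z), Function.comp_apply]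

lemma coe_pow_apply {w : Disc → ℂ} {φ : Disc → Disc} {T : H2 →L[ℂ] H2}
    (hT : ∀ f : H2, ⇑(T f) = weightedComp w φ ⇑f) (n : ℕ) (f : H2) :
    ⇑((T ^ n) f) = (weightedComp w φ ^ n) ⇑f := by
  induction n with
  | zero => rfl
  | succ n ih =>
    rw [pow_succ', pow_succ', Module.End.mul_apply, ← ih]
    exact hT _

end HardySmirnov

end

theorem theorem4p8 (Ω : Set ℂ) (hΩ_open : IsOpen Ω) (hΩ_bdd : Bornology.IsBounded Ω)
    (hΩ_sc : IsSimplyConnected Ω)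
    (hΩ_rect : MeasureTheory.Measure.hausdorffMeasure 1 (frontier Ω) < ⊤)
    (β : HardySmirnov.ConformalBijection Ω)
    (Φ : ℂ → ℂ) (hΦ : DifferentiableOn ℂ Φ Ω) (hΦ_maps : Set.MapsTo Φ Ω Ω)
    (φ : HardySmirnov.Disc → HardySmirnov.Disc)
    (hφ : φ = HardySmirnov.conjMap β (hΦ_maps.restrict Φ Ω Ω))
    (w : HardySmirnov.Disc → ℂ)
    (hw : w = HardySmirnov.smirnovWeight β (hΦ_maps.restrict Φ Ω Ω))
    (α : ℂ) (hα : HardySmirnov.IsDenjoyWolffPoint φ α) (hα_circle : ‖α‖ = 1) :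
    -- `T_{w,φ}` on `H²` is unitarily equivalent to `C_Φ` on `E²(Ω)`, through the unitary `J`
    (∀ f g : HardySmirnov.E2 β,
      (⇑g = ⇑f ∘ hΦ_maps.restrict Φ Ω Ω ↔
        ⇑(HardySmirnov.E2.unitary β g) =
          HardySmirnov.weightedComp w φ ⇑(HardySmirnov.E2.unitary β f))) ∧
    -- if `T = T_{w,φ}` is a bounded operator on `H²`, then the norms of its powers are unbounded,
    -- and its powers do not converge weakly
    (∀ T : HardySmirnov.H2 →L[ℂ] HardySmirnov.H2,
      (∀ f : HardySmirnov.H2, ⇑(T f) = HardySmirnov.weightedComp w φ ⇑f) →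
        ¬ BddAbove (Set.range fun n : ℕ => ‖T ^ n‖) ∧
        ∃ f : HardySmirnov.H2, ¬ ∃ g : HardySmirnov.H2,
          HardySmirnov.TendstoWeakly (fun n => (T ^ n) f) g) ∧
    -- the same without the assumption that `T_{w,φ}` is bounded, or even defined on all of `H²`:
    -- its powers are not uniformly bounded operators on `H²` ...
    (¬ ∃ C : ℝ, ∀ (n : ℕ) (f : HardySmirnov.H2), ∃ g : HardySmirnov.H2,
      ⇑g = (HardySmirnov.weightedComp w φ ^ n) ⇑f ∧ ‖g‖ ≤ C * ‖f‖) ∧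
    -- ... and it is not true that, for every `f` in `H²`, all `T_{w,φ}ⁿ f` lie in `H²` and
    -- converge weakly
    (¬ ∀ f : HardySmirnov.H2, ∃ (u : ℕ → HardySmirnov.H2) (g : HardySmirnov.H2),
      (∀ n, ⇑(u n) = (HardySmirnov.weightedComp w φ ^ n) ⇑f) ∧
        HardySmirnov.TendstoWeakly u g) := by
  subst hφ hw
  set Ψ := hΦ_maps.restrict Φ Ω Ω
  let z : HardySmirnov.Disc := ⟨0, by simp⟩
  have horbit : Tendsto (fun n => ‖((HardySmirnov.conjMap β Ψ)^[n] z : ℂ)‖) atTop (𝓝 1) := by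
    rw [← hα_circle]
    exact ((hα.2 {z} isCompact_singleton).tendsto_at (Set.mem_singleton z)).norm
  have hkey := HardySmirnov.not_exists_bound_weightedComp_pow β hΩ_bdd Ψ z horbit
  have hunbdd : ¬ ∃ C : ℝ, ∀ (n : ℕ) (f : HardySmirnov.H2), ∃ g : HardySmirnov.H2,
      ⇑g = (HardySmirnov.weightedComp (HardySmirnov.smirnovWeight β Ψ)
        (HardySmirnov.conjMap β Ψ) ^ n) ⇑f ∧ ‖g‖ ≤ C * ‖f‖ := by
    rintro ⟨C, hC⟩
    refine hkey ⟨‖HardySmirnov.H2.eval z‖ * C, fun n f => ?_⟩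
    obtain ⟨g, hg, hgC⟩ := hC n f
    rw [← hg, ← HardySmirnov.H2.eval_apply, mul_assoc]
    exact (HardySmirnov.H2.eval z).le_opNorm_of_le hgC
  have hweak : ¬ ∀ f : HardySmirnov.H2, ∃ (u : ℕ → HardySmirnov.H2) (g : HardySmirnov.H2),
      (∀ n, ⇑(u n) = (HardySmirnov.weightedComp (HardySmirnov.smirnovWeight β Ψ)
        (HardySmirnov.conjMap β Ψ) ^ n) ⇑f) ∧ HardySmirnov.TendstoWeakly u g := by
    intro h
    refine hkey (HardySmirnov.exists_bound_of_tendsto β Ψ z fun f => ?_)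
    obtain ⟨u, g, hu, hug⟩ := h f
    refine ⟨g z, (hug (HardySmirnov.H2.eval z)).congr fun n => ?_⟩
    rw [HardySmirnov.H2.eval_apply, hu]
  refine ⟨HardySmirnov.eq_comp_iff_unitary_eq_weightedComp β Ψ, fun T hT => ⟨?_, ?_⟩,
    hunbdd, hweak⟩
  · rintro ⟨C, hC⟩
    exact hunbdd ⟨C, fun n f => ⟨(T ^ n) f, HardySmirnov.coe_pow_apply hT n f,
      (T ^ n).le_of_opNorm_le (hC ⟨n, rfl⟩) f⟩⟩
  · by_contra! h
    refine hweak fun f => ?_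
    obtain ⟨g, hg⟩ := h f
    exact ⟨fun n => (T ^ n) f, g, fun n => HardySmirnov.coe_pow_apply hT n f, hg⟩
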